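/- Let $A=(A(i,j))_{i,j\in\mathbb N}$ be an irreducible infinite $0$-$1$ matrix, let $\Sigma_A=\{x\in\mathbb N^{\mathbb N_0}: A(x_j,x_{j+1})=1 \text{ for all } j\ge 0\}$ with shift map $\sigma$, and write $[s]=\{x\in\Sigma_A: x_0=s\}$. Let $\widetilde{\mathcal O}_A$ be the universal unital $C^*$-algebra generated by partial isometries $S_j$ ($j\in\mathbb N$) such that, with $Q_j=S_j^*S_j$: (EL1) $Q_iQ_j=Q_jQ_i$ for all $i,j$; (EL2) $S_i^*S_j=0$ for $i\ne j$; (EL3) $Q_iS_j=A(i,j)S_j$ for all $i,j$; (EL4) for all finite $X,Y\subset\mathbb N$ such that $A(X,Y,j):=\prod_{x\in X}A(x,j)\prod_{y\in Y}(1-A(y,j))$ is non-zero for only finitely many $j$, $\prod_{x\in X}Q_x\prod_{y\in Y}(1-Q_y)=\sum_jA(X,Y,j)S_jS_j^*$. Let $\mathcal O_A$ be the $C^*$-subalgebra generated by the $S_j$. For a finite word $\alpha=\alpha_0\cdots\alpha_n$ put $S_\alpha=S_{\alpha_0}\cdots S_{\alpha_n}$, with $S_\emptyset=1$. Let $\mathcal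 D_A$ be the commutative $C^*$-algebra which is the closed linear span of the elements $S_\alpha\big(\prod_{i\in F}Q_i\big)S_\alpha^*$, where $\alpha$ is a finite (possibly empty) word, $F\subset\mathbb N$ is finite and, if $\mathcal O_A$ is not unital, $\alpha$ and $F$ are not both empty. Let $X_A$ be the spectrum of $\mathcal D_A$ (its non-zero characters, with the weak-$*$ topology). Let $\pi:\widetilde{\mathcal O}_A\to\mathfrak B(\ell^2(\Sigma_A))$ be the representation with $\pi(S_s)\delta_x=\delta_{sx}$ if $A(s,x_0)=1$ and $\pi(S_s)\delta_x=0$ otherwise, so that $\pi(S_s)^*\delta_x=\delta_{\sigma(x)}$ if $x\in[s]$ and $0$ otherwise. Define $i_1:\Sigma_A\to X_A$ by $i_1(x)(a)=(\pi(a)\delta_x,\delta_x)$. Let $\mathbb F$ be the free group on $\mathbb N$ and $\mathbb F_+$ its submonoid generated by $\mathbb N$. For $g\in\mathbb F$ with reduced form $x_1\cdots x_n$ put $T_g=T_{x_1}\cdots T_{x_n}$, where $T_s=S_s$ and $T_{s^{-1}}=S_s^*$ for $s\in\mathbb N$, and $e_g=T_gT_g^*$. Define $i_2:X_A\to\{0,1\}^{\mathbb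 F}$ by $i_2(\varphi)_g=\varphi(e_g)$ for $g\neq e$ and $i_2(\varphi)_e=1$ (here $e$ is the identity of $\mathbb F$), where $\{0,1\}^{\mathbb F}$ has the product topology and $i_2(X_A)$ the subspace topology. A finite word $\alpha=\alpha_0\cdots\alpha_n$ is admissible if $A(\alpha_j,\alpha_{j+1})=1$ for $0\le j<n$; the empty word is admissible. A configuration $\xi\in\{0,1\}^{\mathbb F}$ has finite stem $\alpha=\alpha_0\cdots\alpha_n$ if $\{g\in\mathbb F_+:\xi_g=1\}=\{e,\alpha_0,\alpha_0\alpha_1,\dots,\alpha\}$ (and it has empty stem if $\{g\in\mathbb F_+:\xi_g=1\}=\{e\}$). Then $i_2\circ i_1(\Sigma_A)$ is a Borel subset of $i_2(X_A)$, and in fact a $G_\delta$ in $i_2(X_A)$. For every finite admissible word $\alpha$ the set $H(\alpha)$ of all $\xi\in i_2(X_A)$ with stem $\alpha$ is closed in $i_2(X_A)$, and $$i_2(X_A)\setminus i_2\circ i_1(\Sigma_A)=\bigcup_{\alpha}H(\alpha),$$ the union being over the countably many finite admissible words $\alpha$. Likewise $i_1(\Sigma_A)$ is a Borel subset, and in fact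 a $G_\delta$, of $X_A$. -/

import Mathlib

open scoped ENNReal

noncomputable section

namespace ExelLaca

/-- An irreducible infinite `0`-`1` matrix over a countably infinite alphabet (indexed by `ℕ`). -/
structure TransitionMatrix where
  entry : Matrix ℕ ℕ ℤ
  zero_or_one : ∀ i j, entry i j = 0 ∨ entry i j = 1
  irreducible : entry.IsIrreducible

theorem TransitionMatrix.exists_next (A : TransitionMatrix) (i : ℕ) : ∃ j, A.entry i j = 1 := by
  obtain ⟨j, hj⟩ := A.irreducible.exists_pos i
  exact ⟨j, (A.zero_or_one i j).resolve_left hj.ne'⟩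

/-- `A(X,Y,j) = ∏_{x ∈ X} A(x,j) ∏_{y ∈ Y} (1 - A(y,j))`. -/
def TransitionMatrix.coeff (A : TransitionMatrix) (X Y : Finset ℕ) (j : ℕ) : ℤ :=
  (∏ x ∈ X, A.entry x j) * ∏ y ∈ Y, (1 - A.entry y j)

/-! ### Exel–Laca families -/

section Families

variable {B C : Type*} [Ring B] [StarRing B] [Ring C] [StarRing C]

/-- The initial projection `Q_j = S_j^* S_j`. -/
def initialProj (S : ℕ → B) (j : ℕ) : B := star (S j) * S j

theorem pairwise_initialProj {S : ℕ → B}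
    (h : ∀ i j, Commute (initialProj S i) (initialProj S j)) (X : Finset ℕ) :
    (X : Set ℕ).Pairwise (Function.onFun Commute (initialProj S)) :=
  fun i _ j _ _ => h i j

theorem pairwise_one_sub_initialProj {S : ℕ → B}
    (h : ∀ i j, Commute (initialProj S i) (initialProj S j)) (X : Finset ℕ) :
    (X : Set ℕ).Pairwise (Function.onFun Commute fun y => 1 - initialProj S y) :=
  fun i _ j _ _ => (Commute.one_left _).sub_left ((Commute.one_right _).sub_right (h i j))

/-- A family of partial isometries satisfying the relations (EL1)–(EL4). -/
structure IsFamily (A : TransitionMatrix) (S : ℕ → B) : Prop where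
  partial_isometry : ∀ j, S j * star (S j) * S j = S j
  comm : ∀ i j, Commute (initialProj S i) (initialProj S j)
  orthogonal : ∀ i j, i ≠ j → star (S i) * S j = 0
  initial_mul : ∀ i j, initialProj S i * S j = A.entry i j • S j
  sum_final : ∀ (X Y : Finset ℕ) (h : {j | A.coeff X Y j ≠ 0}.Finite),
    X.noncommProd (initialProj S) (pairwise_initialProj comm X) *
        Y.noncommProd (fun y => 1 - initialProj S y) (pairwise_one_sub_initialProj comm Y) =
      ∑ j ∈ h.toFinset, A.coeff X Y j • (S j * star (S j))

/-- `S_α = S_{α_0} ⋯ S_{α_n}` for a finite word `α` (and `1` for the empty word). -/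
def wordOp (S : ℕ → B) (α : List ℕ) : B := (α.map S).prod

end Families


/-! ### The universal unital C⋆-algebra `Õ_A` -/

/-- A nonzero unital C⋆-algebra with a family satisfying (EL1)–(EL4). -/
structure Model (A : TransitionMatrix) : Type 1 where
  carrier : Type
  [cstar : CStarAlgebra carrier]
  [nontrivial : Nontrivial carrier]
  S : ℕ → carrier
  isFamily : IsFamily A S

instance (A : TransitionMatrix) (r : Model A) : CStarAlgebra r.carrier := r.cstar

instance (A : TransitionMatrix) (r : Model A) : Nontrivial r.carrier := r.nontrivial

section Families

variable {B : Type*} [CStarAlgebra B] {A : TransitionMatrix} {S : ℕ → B}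

theorem IsFamily.norm_le (hS : IsFamily A S) (j : ℕ) : ‖S j‖ ≤ 1 := by
  have h1 : initialProj S j * initialProj S j = initialProj S j := by
    have := hS.partial_isometry j
    unfold initialProj
    rw [mul_assoc, ← mul_assoc (S j), this]
  have h2 : star (initialProj S j) = initialProj S j := by simp [initialProj]
  have h3 : ‖initialProj S j‖ = ‖initialProj S j‖ * ‖initialProj S j‖ := by
    rw [← CStarRing.norm_star_mul_self (x := initialProj S j), h2, h1]
  have h4 : ‖initialProj S j‖ = ‖S j‖ * ‖S j‖ := CStarRing.norm_star_mul_self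
  have h5 : ‖initialProj S j‖ ≤ 1 := by
    by_contra hlt
    push Not at hlt
    nlinarith
  nlinarith [norm_nonneg (S j)]

end Families

/-- The `ℓ^∞`-product of all models. -/
def BigProduct (A : TransitionMatrix) : Type 1 := lp (fun r : Model A => r.carrier) ∞

/-- The coordinatewise operations and the supremum norm. -/
def bigProductCStarAlgebra (A : TransitionMatrix) : CStarAlgebra (BigProduct A) :=
  letI P := lp (fun r : Model A => r.carrier) ∞
  { (lp.inftyNormedRing : NormedRing P), (inferInstance : StarRing P),
    (inferInstance : NormedAlgebra ℂ P), (inferInstance : CompleteSpace P),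
    (inferInstance : CStarRing P), (inferInstance : StarModule ℂ P) with }

instance (A : TransitionMatrix) : CStarAlgebra (BigProduct A) := bigProductCStarAlgebra A

/-- The family whose coordinate in every model is the family of that model. -/
def bigGen (A : TransitionMatrix) (j : ℕ) : BigProduct A :=
  (⟨fun r => r.S j, memℓp_infty ⟨1, by rintro _ ⟨r, rfl⟩; exact r.isFamily.norm_le j⟩⟩ :
    lp (fun r : Model A => r.carrier) ∞)

/-- The `r`-th coordinate of the product. -/
def bigEval (A : TransitionMatrix) (r : Model A) : BigProduct A →⋆ₐ[ℂ] r.carrier where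
  toFun a := (show lp (fun r : Model A => r.carrier) ∞ from a) r
  map_one' := rfl
  map_mul' _ _ := rfl
  map_zero' := rfl
  map_add' _ _ := rfl
  commutes' _ := rfl
  map_star' _ := rfl

def tildeOSub (A : TransitionMatrix) : StarSubalgebra ℂ (BigProduct A) :=
  (StarAlgebra.adjoin ℂ (Set.range (bigGen A))).topologicalClosure

/-- The universal unital C⋆-algebra `Õ_A` generated by a family with (EL1)–(EL4): the unital
C⋆-algebra generated by the tuple of all such families inside the product of all models
(see `universal_property`). C⋆-algebras of size at most the continuum, such as those generated
by a sequence, all have copies in `Type`, so the models in `Type` suffice. -/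
def TildeO (A : TransitionMatrix) : Type 1 := tildeOSub A

/-- The C⋆-algebra structure inherited from the product. -/
def tildeOCStarAlgebra (A : TransitionMatrix) : CStarAlgebra (TildeO A) :=
  StarSubalgebra.cstarAlgebra (tildeOSub A)
    (h_closed := StarSubalgebra.isClosed_topologicalClosure _)

instance (A : TransitionMatrix) : CStarAlgebra (TildeO A) := tildeOCStarAlgebra A

def inclO (A : TransitionMatrix) : TildeO A →⋆ₐ[ℂ] BigProduct A := (tildeOSub A).subtype

/-- The generating partial isometries `S_j` of `Õ_A`. -/
def gen (A : TransitionMatrix) (j : ℕ) : TildeO A :=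
  (⟨bigGen A j, StarSubalgebra.le_topologicalClosure _
    (StarAlgebra.subset_adjoin ℂ _ ⟨j, rfl⟩)⟩ : tildeOSub A)

theorem map_initialProj {B C : Type*} [CStarAlgebra B] [CStarAlgebra C] (f : B →⋆ₐ[ℂ] C)
    (S : ℕ → B) (j : ℕ) : f (initialProj S j) = initialProj (fun j => f (S j)) j := by
  simp [initialProj, map_star]

theorem comm_of_separating {A : TransitionMatrix} {B : Type*} [CStarAlgebra B]
    {ι : Type*} {C : ι → Type*} [∀ i, CStarAlgebra (C i)] (f : ∀ i, B →⋆ₐ[ℂ] C i)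
    (hf : ∀ x y, (∀ i, f i x = f i y) → x = y) {S : ℕ → B}
    (h : ∀ i, IsFamily A (fun j => f i (S j))) (j k : ℕ) :
    Commute (initialProj S j) (initialProj S k) :=
  hf _ _ fun i => by
    rw [map_mul, map_mul, map_initialProj, map_initialProj]
    exact (h i).comm j k

theorem IsFamily.of_separating {A : TransitionMatrix} {B : Type*} [CStarAlgebra B]
    {ι : Type*} {C : ι → Type*} [∀ i, CStarAlgebra (C i)] (f : ∀ i, B →⋆ₐ[ℂ] C i)
    (hf : ∀ x y, (∀ i, f i x = f i y) → x = y) {S : ℕ → B}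
    (h : ∀ i, IsFamily A (fun j => f i (S j))) : IsFamily A S where
  partial_isometry j := hf _ _ fun i => by simpa [map_star] using (h i).partial_isometry j
  comm := comm_of_separating f hf h
  orthogonal j k hjk := hf _ _ fun i => by simpa [map_star] using (h i).orthogonal j k hjk
  initial_mul j k := hf _ _ fun i => by
    rw [map_mul, map_initialProj, map_zsmul]
    exact (h i).initial_mul j k
  sum_final X Y hXY := hf _ _ fun i => by
    have := (h i).sum_final X Y hXY
    simp only [map_mul, map_sum, map_zsmul, map_star]
    rw [← this]
    congr 1
    · rw [Finset.map_noncommProd]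
      exact Finset.noncommProd_congr rfl (fun x _ => map_initialProj _ _ _) _
    · rw [Finset.map_noncommProd]
      exact Finset.noncommProd_congr rfl
        (fun x _ => by rw [map_sub, map_one, map_initialProj]) _

/-- Evaluation of `Õ_A` in a model. -/
def evalO (A : TransitionMatrix) (r : Model A) : TildeO A →⋆ₐ[ℂ] r.carrier :=
  (bigEval A r).comp (inclO A)

theorem evalO_gen (A : TransitionMatrix) (r : Model A) (j : ℕ) : evalO A r (gen A j) = r.S j := rfl

theorem gen_isFamily (A : TransitionMatrix) : IsFamily A (gen A) :=
  IsFamily.of_separating (evalO A)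
    (fun _ _ h => Subtype.ext (lp.ext (funext fun r => h r))) fun r => r.isFamily

theorem norm_evalO_le (A : TransitionMatrix) (r : Model A) (a : TildeO A) :
    ‖evalO A r a‖ ≤ ‖a‖ :=
  lp.norm_apply_le_norm ENNReal.top_ne_zero
    (show lp (fun r : Model A => r.carrier) ∞ from inclO A a) r

theorem universal_property (A : TransitionMatrix) (B : Type) [CStarAlgebra B] (S : ℕ → B)
    (hS : IsFamily A S) : ∃! f : TildeO A →⋆ₐ[ℂ] B, ∀ j, f (gen A j) = S j := by
  have huniq : ∀ f g : TildeO A →⋆ₐ[ℂ] B, (∀ j, f (gen A j) = S j) → (∀ j, g (gen A j) = S j) →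
      f = g := by
    intro f g hf hg
    have cf : Continuous f :=
      AddMonoidHomClass.continuous_of_bound f 1 fun a => by
        simpa using NonUnitalStarAlgHom.norm_apply_le f a
    have cg : Continuous g :=
      AddMonoidHomClass.continuous_of_bound g 1 fun a => by
        simpa using NonUnitalStarAlgHom.norm_apply_le g a
    refine StarAlgHom.ext_topologicalClosure (S := StarAlgebra.adjoin ℂ (Set.range (bigGen A)))
      (φ := f) (ψ := g) cf cg ?_
    refine StarAlgHom.ext_adjoin ?_
    rintro ⟨_, hx⟩ ⟨j, rfl⟩
    exact (hf j).trans (hg j).symm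
  rcases subsingleton_or_nontrivial B with hB | hB
  · have f0 : TildeO A →⋆ₐ[ℂ] B :=
      { toFun := fun _ => 0
        map_one' := Subsingleton.elim _ _
        map_mul' := fun _ _ => Subsingleton.elim _ _
        map_zero' := rfl
        map_add' := fun _ _ => Subsingleton.elim _ _
        commutes' := fun _ => Subsingleton.elim _ _
        map_star' := fun _ => Subsingleton.elim _ _ }
    exact ⟨f0, fun _ => Subsingleton.elim _ _, fun g hg =>
      huniq _ _ hg fun _ => Subsingleton.elim _ _⟩
  · exact ⟨evalO A ⟨B, S, hS⟩, fun j => rfl, fun g hg => huniq _ _ hg fun _ => rfl⟩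

/-! ### The Markov shift and the representation on `ℓ²(Σ_A)` -/

/-- The Markov shift space `Σ_A`. -/
def Shift (A : TransitionMatrix) : Type := {x : ℕ → ℕ // ∀ j, A.entry (x j) (x (j + 1)) = 1}

namespace Shift

variable {A : TransitionMatrix}

/-- The shift map. -/
def tail (x : Shift A) : Shift A := ⟨fun n => x.1 (n + 1), fun j => x.2 (j + 1)⟩

/-- The sequence `s x_0 x_1 …`, when `A(s, x_0) = 1`. -/
def cons (s : ℕ) (x : Shift A) (h : A.entry s (x.1 0) = 1) : Shift A :=
  ⟨fun n => Nat.casesOn n s x.1, fun j => by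
    cases j with
    | zero => exact h
    | succ j => exact x.2 j⟩

theorem eq_of_tail {x y : Shift A} (h0 : x.1 0 = y.1 0) (h : x.tail = y.tail) : x = y := by
  apply Subtype.ext
  funext n
  cases n with
  | zero => exact h0
  | succ n => exact congrFun (congrArg Subtype.val h) n

theorem cons_eq_iff {s : ℕ} {x y : Shift A} (h : A.entry s (x.1 0) = 1) :
    cons s x h = y ↔ y.1 0 = s ∧ y.tail = x := by
  constructor
  · rintro rfl
    exact ⟨rfl, rfl⟩
  · rintro ⟨h0, h1⟩
    exact eq_of_tail h0.symm h1.symm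

instance (A : TransitionMatrix) : Nonempty (Shift A) := by
  choose f hf using A.exists_next
  exact ⟨⟨fun n => f^[n] 0, fun j => by
    have := hf (f^[j] 0)
    rwa [← Function.iterate_succ_apply' f j 0] at this⟩⟩

end Shift

/-- The Hilbert space `ℓ²(Σ_A)`. -/
abbrev Ell2 (A : TransitionMatrix) : Type := lp (fun _ : Shift A => ℂ) 2

open Classical in
/-- The canonical basis vector `δ_x` of `ℓ²(Σ_A)`. -/
def delta {A : TransitionMatrix} (x : Shift A) : Ell2 A := lp.single 2 x 1

section Rep

variable {A : TransitionMatrix}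

theorem delta_apply (x y : Shift A) [Decidable (y = x)] : delta x y = if y = x then 1 else 0 := by
  classical
  simp only [delta, lp.coeFn_single, Pi.single_apply]
  congr

theorem norm_delta (x : Shift A) : ‖delta x‖ = 1 := by
  classical
  simp [delta, lp.norm_single]

theorem inner_delta_left (x : Shift A) (f : Ell2 A) : inner ℂ (delta x) f = f x := by
  classical
  simp [delta, lp.inner_single_left]

theorem inner_delta_right (x : Shift A) (f : Ell2 A) :
    inner ℂ f (delta x) = star (f x) := by
  classical
  simp [delta, lp.inner_single_right]

theorem summable_shiftOp (s : ℕ) (f : Ell2 A) :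
    Summable (fun y : Shift A => ‖if y.1 0 = s then f y.tail else 0‖ ^ 2) ∧
      ∑' y : Shift A, ‖if y.1 0 = s then f y.tail else 0‖ ^ 2 ≤ ∑' y : Shift A, ‖f y‖ ^ 2 := by
  have hf : Summable (fun y : Shift A => ‖f y‖ ^ 2) := by
    have := (lp.memℓp f).summable (by simp)
    simpa using this
  let K : Set (Shift A) := {y | y.1 0 = s}
  have hinj : Function.Injective (fun y : K => y.1.tail) := by
    rintro ⟨y, hy⟩ ⟨z, hz⟩ h
    exact Subtype.ext (Shift.eq_of_tail (hy.trans hz.symm) h)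
  have heq : (fun y : Shift A => ‖if y.1 0 = s then f y.tail else 0‖ ^ 2) =
      K.indicator (fun y => ‖f y.tail‖ ^ 2) := by
    funext y
    by_cases hy : y.1 0 = s <;> simp [K, Set.indicator, hy]
  have h1 : Summable (fun y : K => ‖f y.1.tail‖ ^ 2) := hf.comp_injective hinj
  rw [heq]
  refine ⟨summable_subtype_iff_indicator.mp h1, ?_⟩
  rw [← tsum_subtype]
  exact h1.tsum_le_tsum_of_inj _ hinj (fun _ _ => by positivity) (fun _ => le_rfl) hf

/-- The operator `T_s` on `ℓ²(Σ_A)`: `(T_s f)(y) = f(σ y)` if `y ∈ [s]` and `0` otherwise,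
that is, `T_s δ_x = δ_{sx}` if `A(s,x_0) = 1` and `T_s δ_x = 0` otherwise
(see `shiftOp_delta`). -/
def shiftOp (A : TransitionMatrix) (s : ℕ) : Ell2 A →L[ℂ] Ell2 A :=
  LinearMap.mkContinuous
    { toFun := fun f => ⟨fun y => if y.1 0 = s then f y.tail else 0, memℓp_gen (by
        simpa using (summable_shiftOp s f).1)⟩
      map_add' := fun f g => by
        ext y
        change (if y.1 0 = s then f y.tail + g y.tail else 0) =
          (if y.1 0 = s then f y.tail else 0) + (if y.1 0 = s then g y.tail else 0)
        split_ifs <;> simp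
      map_smul' := fun c f => by
        ext y
        by_cases hy : y.1 0 = s <;> simp [hy] } 1 (fun f => by
    have key := (summable_shiftOp s f).2
    rw [one_mul]
    refine le_of_sq_le_sq ?_ (norm_nonneg _)
    have h2 : (0 : ℝ) < (2 : ℝ≥0∞).toReal := by simp
    have e1 := lp.norm_rpow_eq_tsum h2 f
    have e2 := fun g : Ell2 A => lp.norm_rpow_eq_tsum h2 g
    simp only [ENNReal.toReal_ofNat, Real.rpow_ofNat] at e1 e2
    rw [e1, e2]
    exact key)

theorem shiftOp_apply (s : ℕ) (f : Ell2 A) (y : Shift A) :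
    shiftOp A s f y = if y.1 0 = s then f y.tail else 0 := rfl

theorem shiftOp_delta (s : ℕ) (x : Shift A) : shiftOp A s (delta x) =
    if h : A.entry s (x.1 0) = 1 then delta (x.cons s h) else 0 := by
  classical
  ext y
  rw [shiftOp_apply]
  split_ifs with h1 h2 h2
  · rw [delta_apply, delta_apply]
    congr 1
    rw [eq_comm (a := y), Shift.cons_eq_iff]
    simp [h1]
  · rw [delta_apply, if_neg]
    · rfl
    · rintro rfl
      exact h2 (h1 ▸ y.2 0)
  · rw [delta_apply, if_neg]
    rintro rfl
    exact h1 rfl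
  · rfl

theorem star_shiftOp_apply (s : ℕ) (f : Ell2 A) (x : Shift A) :
    (star (shiftOp A s)) f x = if h : A.entry s (x.1 0) = 1 then f (x.cons s h) else 0 := by
  rw [← inner_delta_left, ContinuousLinearMap.star_eq_adjoint,
    ContinuousLinearMap.adjoint_inner_right, shiftOp_delta]
  split_ifs with h
  · exact inner_delta_left _ _
  · simp

theorem star_shiftOp_delta (s : ℕ) (x : Shift A) : (star (shiftOp A s)) (delta x) =
    if x.1 0 = s then delta x.tail else 0 := by
  classical
  ext y
  rw [star_shiftOp_apply]
  split_ifs with h1 h2 h2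
  · rw [delta_apply, delta_apply]
    congr 1
    rw [Shift.cons_eq_iff]
    simp [h2, eq_comm]
  · rw [delta_apply, if_neg]
    · rfl
    · rintro rfl
      exact h2 rfl
  · rw [delta_apply, if_neg]
    rintro rfl
    exact h1 (h2 ▸ x.2 0)
  · rfl

theorem initialProj_shiftOp_apply (s : ℕ) (f : Ell2 A) (x : Shift A) :
    initialProj (shiftOp A) s f x = (A.entry s (x.1 0) : ℂ) * f x := by
  rw [initialProj, mul_apply_eq_comp, star_shiftOp_apply]
  rcases A.zero_or_one s (x.1 0) with h | h
  · simp [h]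
  · rw [dif_pos h, h, Int.cast_one, one_mul]
    exact (if_pos rfl : (if s = s then f x else 0) = f x)

theorem finalProj_shiftOp_apply (s : ℕ) (f : Ell2 A) (x : Shift A) :
    (shiftOp A s * star (shiftOp A s)) f x = if x.1 0 = s then f x else 0 := by
  rw [mul_apply_eq_comp, shiftOp_apply]
  split_ifs with h
  · have h1 : A.entry s (x.tail.1 0) = 1 := h ▸ x.2 0
    rw [star_shiftOp_apply, dif_pos h1]
    exact congrArg f ((Shift.cons_eq_iff h1).mpr ⟨h, rfl⟩)
  · rfl

theorem noncommProd_diag_apply (X : Finset ℕ)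
    (D : ℕ → Ell2 A →L[ℂ] Ell2 A) (c : ℕ → Shift A → ℂ)
    (hD : ∀ s f x, D s f x = c s x * f x) (comm) (f : Ell2 A) (x : Shift A) :
    X.noncommProd D comm f x = (∏ s ∈ X, c s x) * f x := by
  induction X using Finset.induction_on with
  | empty => simp
  | insert a X ha ih =>
    rw [Finset.noncommProd_insert_of_notMem _ _ _ _ ha, Finset.prod_insert ha,
      mul_apply_eq_comp, hD, ih, mul_assoc]

theorem shiftOp_isFamily (A : TransitionMatrix) : IsFamily A (shiftOp A) where
  partial_isometry s := by
    ext f x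
    rw [mul_apply_eq_comp, finalProj_shiftOp_apply, shiftOp_apply]
    split_ifs <;> rfl
  comm i j := by
    ext f x
    simp only [mul_apply_eq_comp, initialProj_shiftOp_apply]
    ring
  orthogonal i j hij := by
    ext f x
    rw [mul_apply_eq_comp, star_shiftOp_apply]
    split_ifs with h
    · rw [shiftOp_apply, if_neg (by simpa [Shift.cons] using hij)]
      rfl
    · rfl
  initial_mul i j := by
    ext f x
    rw [mul_apply_eq_comp, initialProj_shiftOp_apply, shiftOp_apply]
    have : (A.entry i j • shiftOp A j) f x = (A.entry i j : ℂ) * shiftOp A j f x := by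
      rw [← Int.cast_smul_eq_zsmul ℂ]
      rfl
    rw [this, shiftOp_apply]
    split_ifs with h
    · rw [h]
    · simp
  sum_final X Y h := by
    ext f x
    have hsum : (∑ j ∈ h.toFinset, A.coeff X Y j • (shiftOp A j * star (shiftOp A j))) f x =
        ∑ j ∈ h.toFinset, (A.coeff X Y j : ℂ) * (if x.1 0 = j then f x else 0) := by
      rw [sum_apply, lp.coeFn_sum, Finset.sum_apply]
      refine Finset.sum_congr rfl fun j _ => ?_
      rw [← finalProj_shiftOp_apply, ← Int.cast_smul_eq_zsmul ℂ]
      rfl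
    rw [hsum, mul_apply_eq_comp]
    refine (noncommProd_diag_apply X _ (fun s x => (A.entry s (x.1 0) : ℂ))
      initialProj_shiftOp_apply _ _ _).trans ?_
    rw [noncommProd_diag_apply Y _ (fun s x => 1 - (A.entry s (x.1 0) : ℂ)) (fun s f x => by
        rw [sub_mul, one_mul, ← initialProj_shiftOp_apply]; rfl)]
    have hc : (∏ s ∈ X, (A.entry s (x.1 0) : ℂ)) * ((∏ s ∈ Y, (1 - (A.entry s (x.1 0) : ℂ))) * f x)
        = (A.coeff X Y (x.1 0) : ℂ) * f x := by
      simp [TransitionMatrix.coeff, mul_assoc]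
    rw [hc]
    simp only [mul_ite, mul_zero, Finset.sum_ite_eq, Set.Finite.mem_toFinset, Set.mem_ofPred_eq]
    split_ifs with h0
    · rfl
    · push Not at h0
      simp [h0]

/-- The model given by the operators `T_s` on `ℓ²(Σ_A)`. -/
def shiftModel (A : TransitionMatrix) : Model A :=
  haveI : Nontrivial (Ell2 A →L[ℂ] Ell2 A) :=
    ⟨⟨1, 0, fun h => by
      have h1 := norm_delta (Classical.arbitrary (Shift A))
      have h2 : delta (Classical.arbitrary (Shift A)) = 0 :=
        congrArg (fun T : Ell2 A →L[ℂ] Ell2 A => T (delta (Classical.arbitrary (Shift A)))) h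
      rw [h2, norm_zero] at h1
      exact zero_ne_one h1⟩⟩
  { carrier := Ell2 A →L[ℂ] Ell2 A
    cstar := inferInstance
    nontrivial := inferInstance
    S := shiftOp A
    isFamily := shiftOp_isFamily A }

/-- The representation `π : Õ_A → 𝔅(ℓ²(Σ_A))` with `π(S_j) = T_j`. -/
def rep (A : TransitionMatrix) : TildeO A →⋆ₐ[ℂ] (Ell2 A →L[ℂ] Ell2 A) :=
  evalO A (shiftModel A)

theorem rep_gen (A : TransitionMatrix) (j : ℕ) : rep A (gen A j) = shiftOp A j := rfl

theorem norm_rep_le (A : TransitionMatrix) (a : TildeO A) : ‖rep A a‖ ≤ ‖a‖ :=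
  norm_evalO_le A (shiftModel A) a

end Rep

/-! ### The algebras `O_A` and `D_A` -/

section Diagonal

variable (A : TransitionMatrix)

/-- `∏_{i ∈ F} Q_i` in `Õ_A`. -/
def finiteProj (F : Finset ℕ) : TildeO A :=
  F.noncommProd (initialProj (gen A)) (pairwise_initialProj (gen_isFamily A).comm F)

/-- `S_α (∏_{i ∈ F} Q_i) S_α^*` in `Õ_A`. -/
def cyl (α : List ℕ) (F : Finset ℕ) : TildeO A :=
  wordOp (gen A) α * finiteProj A F * star (wordOp (gen A) α)

/-- The C⋆-subalgebra `O_A` of `Õ_A` generated by the `S_j`. -/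
def OA : NonUnitalStarSubalgebra ℂ (TildeO A) :=
  (NonUnitalStarAlgebra.adjoin ℂ (Set.range (gen A))).topologicalClosure

/-- `O_A` has a unit. -/
def IsUnitalOA : Prop := ∃ u ∈ OA A, ∀ a ∈ OA A, u * a = a ∧ a * u = a

/-- The elements `S_α (∏_{i ∈ F} Q_i) S_α^*`, for `α` a finite word and `F` a finite set, where
the element `1` (`α` and `F` both empty) is left out if `O_A` is not unital. -/
def diagGenerators : Set (TildeO A) :=
  {a | ∃ (α : List ℕ) (F : Finset ℕ), (F.Nonempty ∨ α ≠ [] ∨ IsUnitalOA A) ∧ a = cyl A α F}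

variable {A}

theorem initialProj_idem (s : ℕ) :
    initialProj (gen A) s * initialProj (gen A) s = initialProj (gen A) s := by
  have := (gen_isFamily A).partial_isometry s
  unfold initialProj
  rw [mul_assoc, ← mul_assoc (gen A s), this]

theorem star_initialProj (s : ℕ) : star (initialProj (gen A) s) = initialProj (gen A) s := by
  simp [initialProj]

theorem finiteProj_empty : finiteProj A ∅ = 1 := by simp [finiteProj]

theorem finiteProj_insert {s : ℕ} {F : Finset ℕ} (h : s ∉ F) :
    finiteProj A (insert s F) = initialProj (gen A) s * finiteProj A F :=
  Finset.noncommProd_insert_of_notMem _ _ _ _ h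

theorem finiteProj_singleton (s : ℕ) : finiteProj A {s} = initialProj (gen A) s :=
  Finset.noncommProd_singleton _ _

theorem initialProj_mul_finiteProj (s : ℕ) (F : Finset ℕ) :
    initialProj (gen A) s * finiteProj A F = finiteProj A (insert s F) := by
  by_cases h : s ∈ F
  · rw [← Finset.insert_erase h, Finset.insert_eq_of_mem (Finset.mem_insert_self _ _),
      finiteProj_insert (Finset.notMem_erase s F), ← mul_assoc, initialProj_idem]
  · rw [finiteProj_insert h]

theorem finiteProj_mul (F G : Finset ℕ) :
    finiteProj A F * finiteProj A G = finiteProj A (F ∪ G) := by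
  induction F using Finset.induction_on with
  | empty => simp [finiteProj_empty]
  | insert s F hs ih =>
    rw [finiteProj_insert hs, mul_assoc, ih, initialProj_mul_finiteProj, Finset.insert_union]

theorem finiteProj_mul_initialProj (s : ℕ) (F : Finset ℕ) :
    finiteProj A F * initialProj (gen A) s = finiteProj A (F ∪ {s}) := by
  rw [← finiteProj_singleton, finiteProj_mul]

theorem star_finiteProj (F : Finset ℕ) : star (finiteProj A F) = finiteProj A F := by
  induction F using Finset.induction_on with
  | empty => simp [finiteProj_empty]
  | insert s F hs ih =>
    rw [finiteProj_insert hs, star_mul, ih, star_initialProj, finiteProj_mul_initialProj,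
      initialProj_mul_finiteProj, Finset.insert_eq, Finset.union_comm]

theorem finiteProj_mul_gen (F : Finset ℕ) (s : ℕ) :
    ∃ c : ℤ, finiteProj A F * gen A s = c • gen A s := by
  induction F using Finset.induction_on with
  | empty => exact ⟨1, by simp [finiteProj_empty]⟩
  | insert t F ht ih =>
    obtain ⟨c, hc⟩ := ih
    refine ⟨c * A.entry t s, ?_⟩
    rw [finiteProj_insert ht, mul_assoc, hc, mul_smul_comm, (gen_isFamily A).initial_mul, mul_smul]

theorem star_gen_mul_finiteProj (F : Finset ℕ) (s : ℕ) :
    ∃ c : ℤ, star (gen A s) * finiteProj A F = c • star (gen A s) := by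
  obtain ⟨c, hc⟩ := finiteProj_mul_gen (A := A) F s
  refine ⟨c, ?_⟩
  have := congrArg star hc
  rwa [star_mul, star_finiteProj, star_zsmul] at this

theorem cyl_nil (F : Finset ℕ) : cyl A [] F = finiteProj A F := by simp [cyl, wordOp]

theorem cyl_cons (s : ℕ) (α : List ℕ) (F : Finset ℕ) :
    cyl A (s :: α) F = gen A s * cyl A α F * star (gen A s) := by
  simp [cyl, wordOp, mul_assoc]

theorem star_cyl (α : List ℕ) (F : Finset ℕ) : star (cyl A α F) = cyl A α F := by
  simp [cyl, star_finiteProj, mul_assoc]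

theorem cyl_mul_initialProj (α : List ℕ) (F : Finset ℕ) (s : ℕ) :
    ∃ (c : ℤ) (G : Finset ℕ), cyl A α F * initialProj (gen A) s = c • cyl A α G := by
  cases α with
  | nil => exact ⟨1, F ∪ {s}, by rw [cyl_nil, finiteProj_mul_initialProj, cyl_nil, one_smul]⟩
  | cons t α =>
    obtain ⟨c, hc⟩ := star_gen_mul_finiteProj (A := A) {s} t
    rw [finiteProj_singleton] at hc
    exact ⟨c, F, by rw [cyl_cons, mul_assoc, hc, mul_smul_comm]⟩

theorem cyl_idem (α : List ℕ) (F : Finset ℕ) : cyl A α F * cyl A α F = cyl A α F := by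
  induction α with
  | nil => rw [cyl_nil, finiteProj_mul, Finset.union_self]
  | cons s α ih =>
    obtain ⟨c, G, hc⟩ := cyl_mul_initialProj (A := A) α F s
    have hcomm : cyl A α F * initialProj (gen A) s = initialProj (gen A) s * cyl A α F := by
      have := congrArg star hc
      rw [star_mul, star_initialProj, star_cyl, star_zsmul, star_cyl, ← hc] at this
      exact this.symm
    have h1 : gen A s * initialProj (gen A) s = gen A s := by
      rw [initialProj, ← mul_assoc, (gen_isFamily A).partial_isometry]
    calc cyl A (s :: α) F * cyl A (s :: α) F
        = gen A s * (cyl A α F * initialProj (gen A) s) * cyl A α F * star (gen A s) := by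
          simp only [cyl_cons, initialProj, mul_assoc]
      _ = gen A s * initialProj (gen A) s * (cyl A α F * cyl A α F) * star (gen A s) := by
          rw [hcomm]; simp only [mul_assoc]
      _ = cyl A (s :: α) F := by rw [h1, ih, cyl_cons]

theorem cyl_mul_cyl (α β : List ℕ) (F G : Finset ℕ) :
    ∃ (c : ℤ) (γ : List ℕ) (H : Finset ℕ), cyl A α F * cyl A β G = c • cyl A γ H ∧
      (F.Nonempty ∨ α ≠ [] → H.Nonempty ∨ γ ≠ []) := by
  induction α generalizing β F G with
  | nil =>
    cases β with
    | nil =>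
      refine ⟨1, [], F ∪ G, by simp [cyl_nil, finiteProj_mul], ?_⟩
      rintro (h | h)
      · exact Or.inl (h.mono Finset.subset_union_left)
      · exact absurd rfl h
    | cons t β =>
      obtain ⟨c, hc⟩ := finiteProj_mul_gen (A := A) F t
      refine ⟨c, t :: β, G, ?_, fun _ => Or.inr (by simp)⟩
      rw [cyl_nil, cyl_cons, ← mul_assoc, ← mul_assoc, hc, smul_mul_assoc, smul_mul_assoc]
  | cons s α ih =>
    cases β with
    | nil =>
      obtain ⟨c, hc⟩ := star_gen_mul_finiteProj (A := A) G s
      refine ⟨c, s :: α, F, ?_, fun _ => Or.inr (by simp)⟩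
      rw [cyl_nil, cyl_cons, mul_assoc, hc, mul_smul_comm]
    | cons t β =>
      by_cases hst : s = t
      · subst hst
        obtain ⟨c, F', hc⟩ := cyl_mul_initialProj (A := A) α F s
        obtain ⟨d, γ, H, hd, -⟩ := ih β F' G
        refine ⟨c * d, s :: γ, H, ?_, fun _ => Or.inr (by simp)⟩
        calc cyl A (s :: α) F * cyl A (s :: β) G
            = gen A s * ((cyl A α F * initialProj (gen A) s) * cyl A β G) * star (gen A s) := by
              simp only [cyl_cons, initialProj, mul_assoc]
          _ = (c * d) • cyl A (s :: γ) H := by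
              rw [hc, smul_mul_assoc, hd, cyl_cons, mul_smul]
              simp only [mul_smul_comm, smul_mul_assoc]
      · refine ⟨0, s :: α, F, ?_, fun _ => Or.inr (by simp)⟩
        have h0 := (gen_isFamily A).orthogonal s t hst
        calc cyl A (s :: α) F * cyl A (t :: β) G
            = gen A s * cyl A α F * (star (gen A s) * gen A t) * cyl A β G * star (gen A t) := by
              simp only [cyl_cons, mul_assoc]
          _ = (0 : ℤ) • cyl A (s :: α) F := by rw [h0]; simp

theorem mul_mem_span_diagGenerators {a b : TildeO A}
    (ha : a ∈ Submodule.span ℂ (diagGenerators A)) (hb : b ∈ Submodule.span ℂ (diagGenerators A)) :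
    a * b ∈ Submodule.span ℂ (diagGenerators A) := by
  have h := Submodule.mul_mem_mul ha hb
  rw [Submodule.span_mul_span] at h
  refine Submodule.span_le.mpr ?_ h
  rintro _ ⟨_, ⟨α, F, h1, rfl⟩, _, ⟨β, G, h2, rfl⟩, rfl⟩
  obtain ⟨c, γ, H, hc, hH⟩ := cyl_mul_cyl (A := A) α β F G
  change cyl A α F * cyl A β G ∈ _
  have hmem : cyl A γ H ∈ Submodule.span ℂ (diagGenerators A) := by
    refine Submodule.subset_span ⟨γ, H, ?_, rfl⟩
    rw [← or_assoc] at h1 ⊢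
    exact h1.imp hH id
  rw [hc]
  exact zsmul_mem hmem c

theorem star_mem_span_diagGenerators {a : TildeO A}
    (ha : a ∈ Submodule.span ℂ (diagGenerators A)) :
    star a ∈ Submodule.span ℂ (diagGenerators A) := by
  induction ha using Submodule.span_induction with
  | mem a ha =>
    obtain ⟨α, F, h, rfl⟩ := ha
    rw [star_cyl]
    exact Submodule.subset_span ⟨α, F, h, rfl⟩
  | zero => rw [star_zero]; exact zero_mem _
  | add a b _ _ ha hb => rw [star_add]; exact add_mem ha hb
  | smul c a _ ha => rw [star_smul]; exact Submodule.smul_mem _ _ ha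

variable (A)

/-- The linear span of the `S_α (∏_{i ∈ F} Q_i) S_α^*`, a `*`-algebra. -/
def diagSpan : NonUnitalStarSubalgebra ℂ (TildeO A) where
  carrier := Submodule.span ℂ (diagGenerators A)
  add_mem' := add_mem
  zero_mem' := zero_mem _
  mul_mem' := mul_mem_span_diagGenerators
  smul_mem' c _ h := Submodule.smul_mem _ c h
  star_mem' := star_mem_span_diagGenerators

/-- The commutative C⋆-algebra `D_A`, the closed linear span of the
`S_α (∏_{i ∈ F} Q_i) S_α^*`. -/
def DA : NonUnitalStarSubalgebra ℂ (TildeO A) := (diagSpan A).topologicalClosure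

/-- The spectrum `X_A` of `D_A`, with the weak-* topology. -/
abbrev XA : Type 1 := WeakDual.characterSpace ℂ (DA A)

variable {A}

theorem cyl_mem (α : List ℕ) (F : Finset ℕ) (h : F.Nonempty ∨ α ≠ []) : cyl A α F ∈ DA A :=
  NonUnitalStarSubalgebra.le_topologicalClosure _
    (Submodule.subset_span ⟨α, F, h.imp_right Or.inl, rfl⟩)

end Diagonal

/-! ### The inclusion `i₁ : Σ_A → X_A` -/

section Inclusion

variable {A : TransitionMatrix}

/-- `R δ_x = (R δ_x, δ_x) δ_x`. -/
def IsDiagAt (x : Shift A) (R : Ell2 A →L[ℂ] Ell2 A) : Prop :=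
  R (delta x) = (inner ℂ (delta x) (R (delta x)) : ℂ) • delta x

theorem inner_delta_self (x : Shift A) : (inner ℂ (delta x) (delta x) : ℂ) = 1 := by
  rw [inner_self_eq_norm_sq_to_K, norm_delta]; simp

theorem isDiagAt_iff (x : Shift A) (R : Ell2 A →L[ℂ] Ell2 A) :
    IsDiagAt x R ↔ ∃ c : ℂ, R (delta x) = c • delta x := by
  refine ⟨fun h => ⟨_, h⟩, fun ⟨c, hc⟩ => ?_⟩
  rw [IsDiagAt, hc, inner_smul_right, inner_delta_self, mul_one]

theorem initialProj_shiftOp_delta (s : ℕ) (x : Shift A) :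
    initialProj (shiftOp A) s (delta x) = (A.entry s (x.1 0) : ℂ) • delta x := by
  classical
  ext y
  rw [initialProj_shiftOp_apply]
  change _ = _ * delta x y
  rw [delta_apply]
  split_ifs with h
  · rw [h]
  · simp

theorem isDiagAt_rep_finiteProj (x : Shift A) (F : Finset ℕ) :
    IsDiagAt x (rep A (finiteProj A F)) := by
  rw [isDiagAt_iff]
  induction F using Finset.induction_on with
  | empty => exact ⟨1, by rw [finiteProj_empty, map_one, one_smul]; rfl⟩
  | insert s F hs ih =>
    obtain ⟨c, hc⟩ := ih
    refine ⟨c * A.entry s (x.1 0), ?_⟩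
    rw [finiteProj_insert hs, map_mul, mul_apply_eq_comp, hc, map_smul, map_initialProj, mul_smul]
    congr 1
    exact initialProj_shiftOp_delta s x

theorem isDiagAt_rep_cyl (x : Shift A) (α : List ℕ) (F : Finset ℕ) :
    IsDiagAt x (rep A (cyl A α F)) := by
  induction α generalizing x with
  | nil => rw [cyl_nil]; exact isDiagAt_rep_finiteProj x F
  | cons s α ih =>
    rw [isDiagAt_iff, cyl_cons, map_mul, map_mul, map_star, rep_gen, mul_apply_eq_comp,
      mul_apply_eq_comp, star_shiftOp_delta]
    split_ifs with h
    · obtain ⟨c, hc⟩ := (isDiagAt_iff _ _).mp (ih x.tail)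
      have h1 : A.entry s (x.tail.1 0) = 1 := h ▸ x.2 0
      refine ⟨c, ?_⟩
      rw [hc, map_smul, shiftOp_delta, dif_pos h1, (Shift.cons_eq_iff h1).mpr ⟨h, rfl⟩]
    · exact ⟨0, by simp⟩

theorem isDiagAt_rep (x : Shift A) (a : TildeO A) (ha : a ∈ DA A) : IsDiagAt x (rep A a) := by
  have hcont : Continuous fun a => rep A a (delta x) := by
    have : Continuous (rep A) := AddMonoidHomClass.continuous_of_bound (rep A) 1 fun a => by
      simpa using norm_rep_le A a
    exact this.clm_apply continuous_const
  have hclosed : IsClosed {a : TildeO A | IsDiagAt x (rep A a)} :=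
    isClosed_eq hcont (Continuous.smul (f := fun a => (inner ℂ (delta x) (rep A a (delta x)) : ℂ))
      (continuous_const.inner hcont) continuous_const)
  refine closure_minimal ?_ hclosed ha
  intro b hb₀
  have hb₁ : b ∈ Submodule.span ℂ (diagGenerators A) := hb₀
  clear hb₀
  change IsDiagAt x (rep A b)
  rw [isDiagAt_iff]
  induction hb₁ using Submodule.span_induction with
  | mem b hb =>
    obtain ⟨α, F, -, rfl⟩ := hb
    exact (isDiagAt_iff _ _).mp (isDiagAt_rep_cyl x α F)
  | zero => exact ⟨0, by simp⟩
  | add b c _ _ hb hc =>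
    obtain ⟨p, hp⟩ := hb
    obtain ⟨q, hq⟩ := hc
    exact ⟨p + q, by rw [map_add, add_apply, hp, hq, add_smul]⟩
  | smul c b _ hb =>
    obtain ⟨p, hp⟩ := hb
    exact ⟨c * p, by rw [map_smul, smul_apply, hp, mul_smul]⟩

/-- The functional `a ↦ (π(a) δ_x, δ_x)` on `D_A`. -/
def evalFunctional (x : Shift A) : DA A →L[ℂ] ℂ :=
  LinearMap.mkContinuous
    { toFun := fun a => inner ℂ (delta x) (rep A (a : TildeO A) (delta x))
      map_add' := fun a b => by simp
      map_smul' := fun c a => by simp } 1 fun a => by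
    calc ‖(inner ℂ (delta x) (rep A (a : TildeO A) (delta x)) : ℂ)‖
        ≤ ‖delta x‖ * ‖rep A (a : TildeO A) (delta x)‖ := norm_inner_le_norm _ _
      _ ≤ 1 * ‖a‖ := by
        rw [norm_delta]
        refine mul_le_mul_of_nonneg_left ?_ zero_le_one
        refine ((rep A (a : TildeO A)).le_opNorm _).trans ?_
        rw [norm_delta, mul_one]
        exact norm_rep_le A a

theorem evalFunctional_mul (x : Shift A) (a b : DA A) :
    evalFunctional x (a * b) = evalFunctional x a * evalFunctional x b := by
  change (inner ℂ (delta x) (rep A ((a : TildeO A) * b) (delta x)) : ℂ) =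
    inner ℂ (delta x) (rep A (a : TildeO A) (delta x)) *
      inner ℂ (delta x) (rep A (b : TildeO A) (delta x))
  have hb := isDiagAt_rep x b b.2
  rw [IsDiagAt] at hb
  rw [map_mul, mul_apply_eq_comp, hb, map_smul, inner_smul_right, inner_smul_right,
    inner_delta_self, mul_one, mul_comm]

theorem evalFunctional_ne_zero (x : Shift A) : evalFunctional x ≠ 0 := by
  intro h
  have h1 : A.entry (x.1 0) (x.tail.1 0) = 1 := x.2 0
  have h2 : rep A (cyl A [x.1 0] ∅) (delta x) = delta x := by
    rw [cyl_cons, cyl_nil, finiteProj_empty, mul_one, map_mul, map_star, rep_gen,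
      mul_apply_eq_comp, star_shiftOp_delta, if_pos rfl, shiftOp_delta, dif_pos h1]
    exact congrArg delta ((Shift.cons_eq_iff h1).mpr ⟨rfl, rfl⟩)
  have h3 : evalFunctional x ⟨cyl A [x.1 0] ∅, cyl_mem _ _ (Or.inr (by simp))⟩ = 1 := by
    change (inner ℂ (delta x) (rep A (cyl A [x.1 0] ∅) (delta x)) : ℂ) = 1
    rw [h2, inner_delta_self]
  rw [h] at h3
  exact zero_ne_one h3

/-- The inclusion `i₁ : Σ_A → X_A`, `i₁(x)(a) = (π(a) δ_x, δ_x)`. -/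
def i₁ (A : TransitionMatrix) (x : Shift A) : XA A :=
  ⟨evalFunctional x, evalFunctional_ne_zero x, evalFunctional_mul x⟩

theorem i₁_apply (x : Shift A) (a : DA A) :
    i₁ A x a = inner ℂ (delta x) (rep A (a : TildeO A) (delta x)) := rfl

end Inclusion

/-! ### The inclusion `i₂ : X_A → {0,1}^𝔽` and stems -/

section Configurations

variable (A : TransitionMatrix)

/-- `S_s` for the letter `s` and `S_s^*` for the letter `s⁻¹`. -/
def letterOp (p : ℕ × Bool) : TildeO A := if p.2 then gen A p.1 else star (gen A p.1)

/-- `T_g = T_{x_1} ⋯ T_{x_n}` for `g` with reduced form `x_1 ⋯ x_n`. -/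
def groupOp (g : FreeGroup ℕ) : TildeO A := (g.toWord.map (letterOp A)).prod

/-- `e_g = T_g T_g^*`. -/
def eProj (g : FreeGroup ℕ) : TildeO A := groupOp A g * star (groupOp A g)

variable {A}

theorem wordProj_neg (L : List (ℕ × Bool)) (s : ℕ) (h : FreeGroup.IsReduced ((s, false) :: L)) :
    ∃ c : ℤ, (c = 0 ∨ c = 1) ∧ (((s, false) :: L).map (letterOp A)).prod *
      star (((s, false) :: L).map (letterOp A)).prod = c • initialProj (gen A) s := by
  induction L generalizing s with
  | nil => exact ⟨1, Or.inr rfl, by simp [letterOp, initialProj]⟩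
  | cons p L ih =>
    obtain ⟨t, b⟩ := p
    rw [FreeGroup.isReduced_cons_cons] at h
    cases b with
    | true =>
      have hst : s ≠ t := fun hst => by simpa using h.1 hst
      refine ⟨0, Or.inl rfl, ?_⟩
      have h0 := (gen_isFamily A).orthogonal s t hst
      have : (((s, false) :: (t, true) :: L).map (letterOp A)).prod = 0 := by
        simp [letterOp, ← mul_assoc, h0]
      rw [this]
      simp
    | false =>
      obtain ⟨c, hc01, hc⟩ := ih t h.2
      refine ⟨c * A.entry t s, ?_, ?_⟩
      · rcases hc01 with rfl | rfl <;> simp [A.zero_or_one]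
      rw [List.map_cons, List.prod_cons, star_mul, mul_assoc, ← mul_assoc _ _ (star _), hc]
      have : letterOp A (s, false) = star (gen A s) := rfl
      rw [this, star_star, smul_mul_assoc, mul_smul_comm, (gen_isFamily A).initial_mul,
        mul_smul_comm, mul_smul]
      rfl

theorem wordProj_eq (L : List (ℕ × Bool)) (hL : L ≠ []) (h : FreeGroup.IsReduced L) :
    ∃ (c : ℤ) (α : List ℕ) (F : Finset ℕ), (c = 0 ∨ c = 1) ∧ (L.map (letterOp A)).prod *
      star (L.map (letterOp A)).prod = c • cyl A α F ∧ (F.Nonempty ∨ α ≠ []) := by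
  induction L with
  | nil => exact absurd rfl hL
  | cons p L ih =>
    obtain ⟨s, b⟩ := p
    cases b with
    | false =>
      obtain ⟨c, hc01, hc⟩ := wordProj_neg (A := A) L s h
      exact ⟨c, [], {s}, hc01, by rw [hc, cyl_nil, finiteProj_singleton], Or.inl (by simp)⟩
    | true =>
      rw [List.map_cons, List.prod_cons, star_mul, mul_assoc, ← mul_assoc _ _ (star _)]
      have hs : letterOp A (s, true) = gen A s := rfl
      rw [hs]
      by_cases hn : L = []
      · subst hn
        refine ⟨1, [s], ∅, Or.inr rfl, ?_, Or.inr (by simp)⟩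
        rw [cyl_cons, cyl_nil, finiteProj_empty]
        simp
      · have hr : FreeGroup.IsReduced L := h.infix ⟨[(s, true)], [], by simp⟩
        obtain ⟨c, α, F, hc01, hc, -⟩ := ih hn hr
        refine ⟨c, s :: α, F, hc01, ?_, Or.inr (by simp)⟩
        rw [hc, cyl_cons, smul_mul_assoc, mul_smul_comm, mul_assoc]

theorem eProj_mem (g : FreeGroup ℕ) (hg : g ≠ 1) : eProj A g ∈ DA A := by
  obtain ⟨c, α, F, -, hc, hF⟩ := wordProj_eq (A := A) g.toWord
    (fun h => hg (FreeGroup.toWord_eq_nil_iff.mp h)) FreeGroup.isReduced_toWord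
  rw [eProj, groupOp, hc]
  exact zsmul_mem (cyl_mem α F hF) c

theorem eProj_idem (g : FreeGroup ℕ) : eProj A g * eProj A g = eProj A g := by
  by_cases hg : g = 1
  · subst hg
    simp [eProj, groupOp]
  · obtain ⟨c, α, F, hc01, hc, -⟩ := wordProj_eq (A := A) g.toWord
      (fun h => hg (FreeGroup.toWord_eq_nil_iff.mp h)) FreeGroup.isReduced_toWord
    rw [eProj, groupOp, hc]
    rcases hc01 with rfl | rfl
    · simp
    · rw [one_smul, cyl_idem]

theorem apply_eProj (φ : XA A) (g : FreeGroup ℕ) (hg : g ≠ 1) :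
    φ ⟨eProj A g, eProj_mem g hg⟩ = 0 ∨ φ ⟨eProj A g, eProj_mem g hg⟩ = 1 := by
  have h : φ ⟨eProj A g, eProj_mem g hg⟩ * φ ⟨eProj A g, eProj_mem g hg⟩ =
      φ ⟨eProj A g, eProj_mem g hg⟩ := by
    rw [← map_mul]
    exact congrArg φ (Subtype.ext (eProj_idem g))
  exact (IsIdempotentElem.iff_eq_zero_or_one (G₀ := ℂ)).mp h

open Classical in
/-- The inclusion `i₂ : X_A → {0,1}^𝔽`, `i₂(φ)_g = φ(e_g)`. Since `e_1 = 1` need not belong to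
`D_A`, the value at `g = 1` is the one of the canonical extension of `φ` to `D_A + ℂ 1`,
namely `φ(1) = 1`. -/
def i₂ (A : TransitionMatrix) (φ : XA A) (g : FreeGroup ℕ) : Bool :=
  if h : g = 1 then true else decide (φ ⟨eProj A g, eProj_mem g h⟩ = 1)

theorem i₂_spec (φ : XA A) (g : FreeGroup ℕ) (hg : g ≠ 1) :
    φ ⟨eProj A g, eProj_mem g hg⟩ = if i₂ A φ g = true then 1 else 0 := by
  simp only [i₂, dif_neg hg, decide_eq_true_eq]
  split_ifs with h
  · exact h
  · exact (apply_eProj φ g hg).resolve_right h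

/-- The positive cone `𝔽₊`, the submonoid of `𝔽` generated by the letters. -/
def positiveCone : Submonoid (FreeGroup ℕ) := Submonoid.closure (Set.range FreeGroup.of)

/-- The element of `𝔽₊` spelled by a finite word. -/
def posWord (α : List ℕ) : FreeGroup ℕ := (α.map FreeGroup.of).prod

/-- `A(α_j, α_{j+1}) = 1` for all consecutive letters of the finite word `α`. -/
def IsAdmissible (A : TransitionMatrix) (α : List ℕ) : Prop :=
  α.IsChain fun i j => A.entry i j = 1

/-- The set `⟦α⟧ = {1, α_0, α_0 α_1, …, α}`. -/
def initialSubwords (α : List ℕ) : Set (FreeGroup ℕ) := {g | ∃ β, β <+: α ∧ g = posWord β}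

/-- The stem of the configuration `ξ` is the finite word `α`. -/
def HasStem (ξ : FreeGroup ℕ → Bool) (α : List ℕ) : Prop :=
  {g | ξ g = true} ∩ positiveCone = initialSubwords α

/-- The space `i₂(X_A)`, with the topology induced by the product topology of `{0,1}^𝔽`. -/
abbrev ConfigSpace (A : TransitionMatrix) : Type := Set.range (i₂ A)

/-- The image `i₂ ∘ i₁ (Σ_A)` in `i₂(X_A)`. -/
def shiftImage (A : TransitionMatrix) : Set (ConfigSpace A) :=
  {ξ | (ξ : FreeGroup ℕ → Bool) ∈ Set.range (i₂ A ∘ i₁ A)}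

/-- The configurations in `i₂(X_A)` with stem `α`. -/
def withStem (A : TransitionMatrix) (α : List ℕ) : Set (ConfigSpace A) :=
  {ξ | HasStem ξ α}

end Configurations

end ExelLaca

end

namespace ExelLaca

variable {A : TransitionMatrix}

/-! ### Products of the elements `S_α (∏_{i ∈ F} Q_i) S_α^*` -/

/-! Say that a character `φ` of `D_A` charges a finite word `α` if the configuration `i₂ A φ` is
`true` at `posWord α`; for nonempty `α` this means `φ(S_α S_α^*) = 1`. Everything follows from the
multiplication of the elements `cyl A α F`. If `α` is a prefix of `β`, then `S_α S_α^*` dominates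
`S_β S_β^*`; if neither word is a prefix of the other, the product is `0`; and `S_α S_α^*` vanishes
unless `α` is admissible. Hence the words charged by `φ` are admissible, are closed under prefixes,
and form a chain. Either there is a longest one, which is then the stem (`hasStem_iff`), or they are
exactly the initial words of an infinite sequence `x` in `Σ_A` (`exists_initialWord_of_unbounded`).

In the second case `φ` is `i₁ A x`. Indeed, when `β` is longer than `α`, multiplying `S_β S_β^*` by
`cyl A α F` only rescales it by an integer (`cyl_mul_cyl_of_length_lt`). If `φ` charges `β`, its
value on `cyl A α F` is therefore that integer. So `φ` is determined on a dense subspace by the long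
words it charges (`eq_of_i₂_initialWord`), and `i₁ A x` charges the same words. Conversely, `i₁ A x`
charges words of every length and has no finite stem. This gives the decomposition of the
complement.

To have stem `α` is a condition on one coordinate for each word, so it is closed. There are
countably many words, so the complement of the image of `Σ_A` is a countable union of closed sets.
Finally `i₂` is continuous, and the range of `i₁` is the full preimage of that image, which
transfers the result to `X_A`. -/

theorem gen_mul_initialProj (s : ℕ) : gen A s * initialProj (gen A) s = gen A s := by
  rw [initialProj, ← mul_assoc, (gen_isFamily A).partial_isometry]

/-- The product is an integer multiple of a self-adjoint element, hence self-adjoint; two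
self-adjoint elements with self-adjoint product commute. -/
theorem cyl_commute_initialProj (α : List ℕ) (F : Finset ℕ) (s : ℕ) :
    Commute (cyl A α F) (initialProj (gen A) s) := by
  obtain ⟨c, G, hc⟩ := cyl_mul_initialProj (A := A) α F s
  have := congrArg star hc
  rw [star_mul, star_initialProj, star_cyl, star_zsmul, star_cyl, ← hc] at this
  exact this.symm

/-- The inner factor `S_s^* S_s = Q_s` commutes past `cyl A α F` and is absorbed by `S_s`. This
reduces products to shorter words and drives the inductions that follow. -/
theorem cyl_cons_mul_cyl_cons (s : ℕ) (α β : List ℕ) (F G : Finset ℕ) :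
    cyl A (s :: α) F * cyl A (s :: β) G = gen A s * (cyl A α F * cyl A β G) * star (gen A s) := by
  calc cyl A (s :: α) F * cyl A (s :: β) G
      = gen A s * (cyl A α F * initialProj (gen A) s) * cyl A β G * star (gen A s) := by
        simp only [cyl_cons, initialProj, mul_assoc]
    _ = gen A s * initialProj (gen A) s * (cyl A α F * cyl A β G) * star (gen A s) := by
        rw [(cyl_commute_initialProj α F s).eq]; simp only [mul_assoc]
    _ = _ := by rw [gen_mul_initialProj]

theorem cyl_cons_mul_cyl_cons_of_ne {s t : ℕ} (h : s ≠ t) (α β : List ℕ) (F G : Finset ℕ) :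
    cyl A (s :: α) F * cyl A (t :: β) G = 0 := by
  calc cyl A (s :: α) F * cyl A (t :: β) G
      = gen A s * cyl A α F * (star (gen A s) * gen A t) * cyl A β G * star (gen A t) := by
        simp only [cyl_cons, mul_assoc]
    _ = 0 := by rw [(gen_isFamily A).orthogonal s t h]; simp

theorem cyl_mul_cyl_of_prefix {α β : List ℕ} (h : α <+: β) :
    cyl A α ∅ * cyl A β ∅ = cyl A β ∅ := by
  induction α generalizing β with
  | nil => rw [cyl_nil, finiteProj_empty, one_mul]
  | cons s α ih =>
    obtain ⟨γ, rfl⟩ := h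
    rw [List.cons_append, cyl_cons_mul_cyl_cons, ih (List.prefix_append α γ), ← cyl_cons]

/-- Common first letters are peeled off until the words differ, where (EL2) makes the product zero.
-/
theorem cyl_mul_cyl_of_not_prefix {α β : List ℕ} (h₁ : ¬ α <+: β) (h₂ : ¬ β <+: α)
    (F G : Finset ℕ) : cyl A α F * cyl A β G = 0 := by
  induction α generalizing β with
  | nil => exact absurd List.nil_prefix h₁
  | cons s α ih =>
    cases β with
    | nil => exact absurd List.nil_prefix h₂
    | cons t β =>
      by_cases hst : s = t
      · subst hst
        rw [List.prefix_cons_inj] at h₁ h₂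
        rw [cyl_cons_mul_cyl_cons, ih h₁ h₂, mul_zero, zero_mul]
      · exact cyl_cons_mul_cyl_cons_of_ne hst _ _ _ _

/-- If `α` is a prefix of `β`, the projections `Q_i` meet the letter of `β` that follows `α`, and
(EL3) turns them into scalars. Strictness of the length inequality guarantees that such a letter
exists; for `α = β` the factor from `F` would remain. -/
theorem cyl_mul_cyl_of_length_lt {α β : List ℕ} (h : α.length < β.length) (F : Finset ℕ) :
    ∃ c : ℤ, cyl A α F * cyl A β ∅ = c • cyl A β ∅ := by
  induction α generalizing β with
  | nil =>
    cases β with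
    | nil => simp at h
    | cons t β =>
      obtain ⟨c, hc⟩ := finiteProj_mul_gen (A := A) F t
      exact ⟨c, by rw [cyl_nil, cyl_cons, ← mul_assoc, ← mul_assoc, hc, smul_mul_assoc,
        smul_mul_assoc]⟩
  | cons s α ih =>
    cases β with
    | nil => simp at h
    | cons t β =>
      by_cases hst : s = t
      · subst hst
        obtain ⟨c, hc⟩ := ih (by simpa using h)
        exact ⟨c, by rw [cyl_cons_mul_cyl_cons, hc, mul_smul_comm, smul_mul_assoc, cyl_cons]⟩
      · exact ⟨0, by rw [cyl_cons_mul_cyl_cons_of_ne hst, zero_smul]⟩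

/-- By (EL3), `S_s S_t = S_s Q_s S_t = A(s,t) S_s S_t`, so a forbidden transition annihilates the
whole product. -/
theorem isAdmissible_of_cyl_ne_zero {α : List ℕ} {F : Finset ℕ} (h : cyl A α F ≠ 0) :
    IsAdmissible A α := by
  induction α with
  | nil => exact List.isChain_nil
  | cons s α ih =>
    have hα : IsAdmissible A α := ih fun h0 => h (by rw [cyl_cons, h0, mul_zero, zero_mul])
    cases α with
    | nil => exact List.isChain_singleton s
    | cons t α =>
      refine List.isChain_cons_cons.mpr ⟨(A.zero_or_one s t).resolve_left fun h0 => h ?_, hα⟩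
      have hst : gen A s * gen A t = 0 := by
        rw [← gen_mul_initialProj s, mul_assoc, (gen_isFamily A).initial_mul, h0, zero_smul,
          mul_zero]
      rw [cyl_cons, cyl_cons, mul_assoc (gen A t), ← mul_assoc (gen A s), hst, zero_mul, zero_mul]

/-! ### Positive words in the free group -/

theorem toWord_posWord (α : List ℕ) : (posWord α).toWord = α.map fun s => (s, true) := by
  have h : posWord α = FreeGroup.mk (α.map fun s => (s, true)) := by
    induction α with
    | nil => rfl
    | cons s α ih =>
      change FreeGroup.of s * posWord α = _
      rw [ih, FreeGroup.of, FreeGroup.mul_mk]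
      rfl
  rw [h, FreeGroup.toWord_mk]
  refine FreeGroup.IsReduced.reduce_eq ?_
  -- All exponents are positive, so no two neighbouring letters can cancel and the word is already
  -- reduced.
  rw [FreeGroup.IsReduced, List.isChain_map, List.isChain_iff_getElem]
  exact fun _ _ _ => rfl

theorem posWord_injective : Function.Injective posWord := fun α β h => by
  have := congrArg FreeGroup.toWord h
  rw [toWord_posWord, toWord_posWord] at this
  exact List.map_injective_iff.mpr (fun a b hab => congrArg Prod.fst hab) this

theorem mem_positiveCone_iff (g : FreeGroup ℕ) : g ∈ positiveCone ↔ ∃ α, posWord α = g := by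
  constructor
  · intro h
    induction h using Submonoid.closure_induction with
    | mem x hx =>
      obtain ⟨s, rfl⟩ := hx
      exact ⟨[s], by simp [posWord]⟩
    | one => exact ⟨[], rfl⟩
    | mul x y _ _ hx hy =>
      obtain ⟨α, rfl⟩ := hx
      obtain ⟨β, rfl⟩ := hy
      exact ⟨α ++ β, by simp [posWord]⟩
  · rintro ⟨α, rfl⟩
    refine Submonoid.list_prod_mem _ fun g hg => ?_
    obtain ⟨s, -, rfl⟩ := List.mem_map.mp hg
    exact Submonoid.subset_closure ⟨s, rfl⟩

theorem posWord_mem_initialSubwords {α β : List ℕ} :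
    posWord β ∈ initialSubwords α ↔ β <+: α := by
  constructor
  · rintro ⟨γ, hγ, h⟩
    rwa [posWord_injective h]
  · exact fun h => ⟨β, h, rfl⟩

/-- Since `posWord` is injective with image the positive cone, the equality of sets splits into one
condition per finite word. This form serves both the closedness of `withStem` and the search for a
stem. -/
theorem hasStem_iff (ξ : FreeGroup ℕ → Bool) (α : List ℕ) :
    HasStem ξ α ↔ ∀ β, ξ (posWord β) = true ↔ β <+: α := by
  rw [HasStem, Set.ext_iff]
  constructor
  · intro h β
    rw [← posWord_mem_initialSubwords, ← h]
    exact ⟨fun hβ => ⟨hβ, (mem_positiveCone_iff _).mpr ⟨β, rfl⟩⟩, fun hβ => hβ.1⟩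
  · intro h g
    constructor
    · rintro ⟨h1, h2⟩
      obtain ⟨β, rfl⟩ := (mem_positiveCone_iff g).mp h2
      exact ⟨β, (h β).mp h1, rfl⟩
    · rintro ⟨β, hβ, rfl⟩
      exact ⟨(h β).mpr hβ, (mem_positiveCone_iff _).mpr ⟨β, rfl⟩⟩

theorem isClosed_withStem (α : List ℕ) : IsClosed (withStem A α) := by
  have h : withStem A α = ⋂ β : List ℕ,
      (fun ξ : ConfigSpace A => (ξ : FreeGroup ℕ → Bool) (posWord β)) ⁻¹'
        {b | b = true ↔ β <+: α} := by
    ext ξ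
    rw [Set.mem_iInter]
    exact hasStem_iff _ α
  rw [h]
  -- Each condition involves a single coordinate with values in the discrete space `Bool`.
  exact isClosed_iInter fun β => (isClosed_discrete _).preimage
    ((continuous_apply _).comp continuous_subtype_val)

/-! ### Positive words in the configuration of a character -/

theorem groupOp_posWord (α : List ℕ) : groupOp A (posWord α) = wordOp (gen A) α := by
  rw [groupOp, toWord_posWord, wordOp, List.map_map]
  rfl

theorem eProj_posWord (α : List ℕ) : eProj A (posWord α) = cyl A α ∅ := by
  rw [eProj, groupOp_posWord, cyl, finiteProj_empty, mul_one]

/-- At the identity the value is set by convention and `φ` is not evaluated, because `1` may lie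
outside `D_A`. This is why the empty word is treated separately in the arguments about charged
words. -/
theorem i₂_posWord_nil (φ : XA A) : i₂ A φ (posWord []) = true := dif_pos rfl

theorem i₂_posWord_iff (φ : XA A) {α : List ℕ} (hα : α ≠ []) :
    i₂ A φ (posWord α) = true ↔ φ ⟨cyl A α ∅, cyl_mem α ∅ (Or.inr hα)⟩ = 1 := by
  have h1 : posWord α ≠ 1 := fun h => hα (posWord_injective h)
  have h2 : (⟨eProj A (posWord α), eProj_mem _ h1⟩ : DA A) =
      ⟨cyl A α ∅, cyl_mem α ∅ (Or.inr hα)⟩ := Subtype.ext (eProj_posWord α)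
  rw [← h2, i₂_spec φ _ h1]
  split_ifs with h <;> simp [h]

/-- Multiplicativity of `φ` applied to `cyl_mul_cyl_of_prefix` gives `φ(S_α S_α^*) · 1 = 1`. -/
theorem i₂_posWord_of_prefix (φ : XA A) {α β : List ℕ} (h : α <+: β)
    (hβ : i₂ A φ (posWord β) = true) : i₂ A φ (posWord α) = true := by
  by_cases hα : α = []
  · subst hα
    exact i₂_posWord_nil φ
  have hβ0 : β ≠ [] := by
    rintro rfl
    exact hα (List.prefix_nil.mp h)
  rw [i₂_posWord_iff φ hα]
  rw [i₂_posWord_iff φ hβ0] at hβ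
  have key : (⟨cyl A α ∅, cyl_mem α ∅ (Or.inr hα)⟩ * ⟨cyl A β ∅, cyl_mem β ∅ (Or.inr hβ0)⟩ : DA A) =
      ⟨cyl A β ∅, cyl_mem β ∅ (Or.inr hβ0)⟩ := Subtype.ext (cyl_mul_cyl_of_prefix h)
  have := congrArg φ key
  rwa [map_mul, hβ, mul_one] at this

/-- For incomparable words the two projections are orthogonal, so `φ` cannot take the value `1` on
both. -/
theorem prefix_or_prefix_of_i₂_posWord (φ : XA A) {α β : List ℕ}
    (hα : i₂ A φ (posWord α) = true) (hβ : i₂ A φ (posWord β) = true) :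
    α <+: β ∨ β <+: α := by
  by_contra! h
  have hα0 : α ≠ [] := by
    rintro rfl
    exact h.1 List.nil_prefix
  have hβ0 : β ≠ [] := by
    rintro rfl
    exact h.2 List.nil_prefix
  rw [i₂_posWord_iff φ hα0] at hα
  rw [i₂_posWord_iff φ hβ0] at hβ
  have key : (⟨cyl A α ∅, cyl_mem α ∅ (Or.inr hα0)⟩ * ⟨cyl A β ∅, cyl_mem β ∅ (Or.inr hβ0)⟩ : DA A) =
      0 := Subtype.ext (cyl_mul_cyl_of_not_prefix h.1 h.2 ∅ ∅)
  have := congrArg φ key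
  rw [map_mul, hα, hβ, map_zero] at this
  simp at this

theorem isAdmissible_of_i₂_posWord (φ : XA A) {α : List ℕ}
    (hα : i₂ A φ (posWord α) = true) : IsAdmissible A α := by
  by_cases hα0 : α = []
  · subst hα0
    exact List.isChain_nil
  refine isAdmissible_of_cyl_ne_zero (F := ∅) fun h => ?_
  rw [i₂_posWord_iff φ hα0] at hα
  have h0 : (⟨cyl A α ∅, cyl_mem α ∅ (Or.inr hα0)⟩ : DA A) = 0 := Subtype.ext h
  rw [h0, map_zero] at hα
  exact zero_ne_one hα

/-! ### Initial words of points of `Σ_A` and the characters they determine -/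

namespace Shift

/-- The word `x_0 ⋯ x_{n-1}`. -/
def initialWord (x : Shift A) (n : ℕ) : List ℕ := (List.range n).map x.1

theorem length_initialWord (x : Shift A) (n : ℕ) : (x.initialWord n).length = n := by
  simp [initialWord]

theorem initialWord_succ (x : Shift A) (n : ℕ) :
    x.initialWord (n + 1) = x.1 0 :: x.tail.initialWord n := by
  rw [initialWord, List.range_succ_eq_map, List.map_cons, List.map_map]
  rfl

end Shift

/-- The adjoint `S_α^*` strips the first `n` letters from `x`, and `S_α` puts them back. -/
theorem rep_cyl_initialWord (x : Shift A) (n : ℕ) :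
    rep A (cyl A (x.initialWord n) ∅) (delta x) = delta x := by
  induction n generalizing x with
  | zero =>
    change rep A (cyl A [] ∅) (delta x) = delta x
    rw [cyl_nil, finiteProj_empty, map_one]
    rfl
  | succ n ih =>
    have h1 : A.entry (x.1 0) (x.tail.1 0) = 1 := x.2 0
    rw [Shift.initialWord_succ, cyl_cons, map_mul, map_mul, map_star, rep_gen, mul_apply_eq_comp,
      mul_apply_eq_comp, star_shiftOp_delta, if_pos rfl, ih, shiftOp_delta, dif_pos h1]
    exact congrArg delta ((Shift.cons_eq_iff h1).mpr ⟨rfl, rfl⟩)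

theorem i₂_i₁_initialWord (x : Shift A) (n : ℕ) :
    i₂ A (i₁ A x) (posWord (x.initialWord n)) = true := by
  cases n with
  | zero => exact i₂_posWord_nil _
  | succ n =>
    rw [i₂_posWord_iff _ (by simp [Shift.initialWord_succ]), i₁_apply, rep_cyl_initialWord,
      inner_delta_self]

/-- A character of `D_A` is determined by an infinite word all of whose initial words it charges. -/
theorem eq_of_i₂_initialWord {x : ℕ → List ℕ} (hx : ∀ n, (x n).length = n) {φ ψ : XA A}
    (hφ : ∀ n, i₂ A φ (posWord (x n)) = true) (hψ : ∀ n, i₂ A ψ (posWord (x n)) = true) :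
    φ = ψ := by
  have mem : ∀ b ∈ Submodule.span ℂ (diagGenerators A), b ∈ DA A := fun b hb =>
    NonUnitalStarSubalgebra.le_topologicalClosure (diagSpan A) hb
  -- The proof of membership in `D_A` stays quantified so that the induction over the span can
  -- change the element.
  have hspan : ∀ b (hb : b ∈ Submodule.span ℂ (diagGenerators A)) (hb' : b ∈ DA A),
      φ ⟨b, hb'⟩ = ψ ⟨b, hb'⟩ := by
    intro b hb
    induction hb using Submodule.span_induction with
    | mem b hb =>
      intro hb'
      obtain ⟨α, F, -, rfl⟩ := hb
      -- One letter more than `α` is enough for the rescaling lemma; the resulting integer `c` is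
      -- the same for `φ` and `ψ`.
      have hlt : α.length < (x (α.length + 1)).length := by rw [hx]; omega
      have hne : x (α.length + 1) ≠ [] := by
        rw [← List.length_pos_iff]
        omega
      obtain ⟨c, hc⟩ := cyl_mul_cyl_of_length_lt (A := A) hlt F
      have key : (⟨cyl A α F, hb'⟩ * ⟨_, cyl_mem _ ∅ (Or.inr hne)⟩ : DA A) =
          c • ⟨_, cyl_mem _ ∅ (Or.inr hne)⟩ := Subtype.ext hc
      have value : ∀ χ : XA A, i₂ A χ (posWord (x (α.length + 1))) = true →
          χ ⟨cyl A α F, hb'⟩ = c := fun χ hχ => by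
        have := congrArg χ key
        rw [i₂_posWord_iff χ hne] at hχ
        rw [map_mul, map_zsmul, hχ, mul_one] at this
        simpa using this
      rw [value φ (hφ _), value ψ (hψ _)]
    | zero =>
      intro hb'
      exact (map_zero φ).trans (map_zero ψ).symm
    | add b c hb hc ihb ihc =>
      intro hb'
      have h : (⟨b + c, hb'⟩ : DA A) = ⟨b, mem b hb⟩ + ⟨c, mem c hc⟩ := rfl
      rw [h, map_add, map_add, ihb, ihc]
    | smul r b hb ihb =>
      intro hb'
      have h : (⟨r • b, hb'⟩ : DA A) = r • ⟨b, mem b hb⟩ := rfl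
      rw [h, map_smul, map_smul, ihb]
  refine DFunLike.ext _ _ fun a => ?_
  have hclosed : IsClosed {a : DA A | φ a = ψ a} :=
    isClosed_eq (map_continuous φ) (map_continuous ψ)
  -- `D_A` is a closure taken in `Õ_A`; `closure_subtype` turns this into density of the span in
  -- `D_A` with its own topology.
  have hdense : a ∈ closure {a : DA A | (a : TildeO A) ∈ diagSpan A} := by
    rw [closure_subtype]
    have : Subtype.val '' {a : DA A | (a : TildeO A) ∈ diagSpan A} = (diagSpan A : Set (TildeO A)) := by
      ext b
      constructor
      · rintro ⟨a, ha, rfl⟩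
        exact ha
      · exact fun hb => ⟨⟨b, NonUnitalStarSubalgebra.le_topologicalClosure _ hb⟩, hb, rfl⟩
    rw [this]
    exact a.2
  have hsub : {a : DA A | (a : TildeO A) ∈ diagSpan A} ⊆ {a : DA A | φ a = ψ a} := by
    rintro ⟨b, hb'⟩ hb
    exact hspan b hb hb'
  exact closure_minimal hsub hclosed hdense

theorem eq_i₁_of_i₂_initialWord {φ : XA A} {x : Shift A}
    (h : ∀ n, i₂ A φ (posWord (x.initialWord n)) = true) : φ = i₁ A x :=
  eq_of_i₂_initialWord x.length_initialWord h (i₂_i₁_initialWord x)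

/-! ### Finite and infinite stems -/

/-- Truncation yields a charged word of each exact length. These words are nested because charged
words form a chain, so they glue to one infinite sequence. -/
theorem exists_initialWord_of_unbounded (φ : XA A)
    (h : ∀ n : ℕ, ∃ α : List ℕ, n ≤ α.length ∧ i₂ A φ (posWord α) = true) :
    ∃ x : Shift A, ∀ n, i₂ A φ (posWord (x.initialWord n)) = true := by
  have h' : ∀ n : ℕ, ∃ α : List ℕ, α.length = n ∧ i₂ A φ (posWord α) = true := fun n => by
    obtain ⟨α, hn, hα⟩ := h n
    exact ⟨α.take n, by simpa using hn, i₂_posWord_of_prefix φ (List.take_prefix n α) hα⟩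
  choose w hlen hw using h'
  have hpre : ∀ m n, m ≤ n → w m <+: w n := fun m n hmn => by
    rcases prefix_or_prefix_of_i₂_posWord φ (hw m) (hw n) with h | h
    · exact h
    · rw [h.eq_of_length_le (by rw [hlen, hlen]; exact hmn)]
  -- The letter in position `k` is read off from `w (k + 1)`, the shortest of the words that has
  -- this position; all longer ones agree with it.
  have hget : ∀ k n (hk : k < n),
      (w (k + 1))[k]'(by rw [hlen]; omega) = (w n)[k]'(by rw [hlen]; exact hk) := fun k n hk =>
    (hpre (k + 1) n hk).getElem _
  have hadm : ∀ j, A.entry ((w (j + 1))[j]'(by rw [hlen]; omega))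
      ((w (j + 1 + 1))[j + 1]'(by rw [hlen]; omega)) = 1 := fun j => by
    -- Both letters of the transition are placed in the single word `w (j + 2)`, which is admissible
    -- because it is charged.
    rw [hget j (j + 2) (by omega)]
    exact List.isChain_iff_getElem.mp (isAdmissible_of_i₂_posWord φ (hw (j + 2))) j
      (by rw [hlen]; omega)
  obtain ⟨x, hx⟩ : ∃ x : Shift A, ∀ k, x.1 k = (w (k + 1))[k]'(by rw [hlen]; omega) :=
    ⟨⟨_, hadm⟩, fun k => rfl⟩
  refine ⟨x, fun n => ?_⟩
  have : x.initialWord n = w n := by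
    refine List.ext_getElem (by rw [x.length_initialWord, hlen]) fun k h1 h2 => ?_
    rw [hlen] at h2
    simpa [Shift.initialWord, hx] using hget k n h2
  rw [this]
  exact hw n

/-- A configuration in `i₂(X_A)` without finite stem comes from a point of `Σ_A`. -/
theorem exists_hasStem_or_mem_range (φ : XA A) :
    (∃ α, IsAdmissible A α ∧ HasStem (i₂ A φ) α) ∨ φ ∈ Set.range (i₁ A) := by
  -- The dichotomy is whether some charged word has maximal length. Such a word is the stem, since
  -- every charged word is comparable with it and no longer.
  by_cases hb : ∃ α, i₂ A φ (posWord α) = true ∧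
      ∀ β, i₂ A φ (posWord β) = true → β.length ≤ α.length
  · obtain ⟨α, hα, hmax⟩ := hb
    refine Or.inl ⟨α, isAdmissible_of_i₂_posWord φ hα, (hasStem_iff _ _).mpr fun β =>
      ⟨fun hβ => ?_, fun hβ => i₂_posWord_of_prefix φ hβ hα⟩⟩
    rcases prefix_or_prefix_of_i₂_posWord φ hβ hα with h | h
    · exact h
    · rw [h.eq_of_length_le (hmax β hβ)]
  · push Not at hb
    -- Without a longest charged word, the lengths grow without bound, starting from the empty word.
    have h : ∀ n : ℕ, ∃ α : List ℕ, n ≤ α.length ∧ i₂ A φ (posWord α) = true := fun n => by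
      induction n with
      | zero => exact ⟨[], Nat.zero_le _, i₂_posWord_nil φ⟩
      | succ n ih =>
        obtain ⟨α, hn, hα⟩ := ih
        obtain ⟨β, hβ, hlt⟩ := hb α hα
        exact ⟨β, by omega, hβ⟩
    obtain ⟨x, hx⟩ := exists_initialWord_of_unbounded φ h
    exact Or.inr ⟨x, (eq_i₁_of_i₂_initialWord hx).symm⟩

/-- The initial word of `x` of length `α.length + 1` is charged but too long to be a prefix of `α`.
-/
theorem not_hasStem_i₂_i₁ (x : Shift A) (α : List ℕ) : ¬ HasStem (i₂ A (i₁ A x)) α := fun h => by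
  have := (((hasStem_iff _ _).mp h _).mp (i₂_i₁_initialWord x (α.length + 1))).length_le
  rw [Shift.length_initialWord] at this
  omega

/-! ### The images of `Σ_A` as `G_δ` sets -/

theorem compl_shiftImage (A : TransitionMatrix) :
    (shiftImage A)ᶜ = ⋃ α ∈ {α : List ℕ | IsAdmissible A α}, withStem A α := by
  ext ξ
  obtain ⟨_, φ, rfl⟩ := ξ
  simp only [Set.mem_compl_iff, Set.mem_iUnion]
  constructor
  · intro h
    rcases exists_hasStem_or_mem_range φ with ⟨α, hα, hs⟩ | ⟨x, rfl⟩
    · exact ⟨α, hα, hs⟩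
    · exact absurd ⟨x, rfl⟩ h
  · rintro ⟨α, -, hs⟩ ⟨x, hx⟩
    refine not_hasStem_i₂_i₁ x α ?_
    have hx' : i₂ A (i₁ A x) = i₂ A φ := hx
    rw [hx']
    exact hs

theorem isGδ_shiftImage (A : TransitionMatrix) : IsGδ (shiftImage A) := by
  rw [← compl_compl (shiftImage A), compl_shiftImage]
  simp only [Set.compl_iUnion]
  exact IsGδ.biInter (Set.to_countable _) fun α _ => (isClosed_withStem α).isOpen_compl.isGδ

theorem continuous_i₂ (A : TransitionMatrix) : Continuous (i₂ A) := by
  refine continuous_pi fun g => ?_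
  by_cases hg : g = 1
  · subst hg
    simpa [i₂] using continuous_const
  have heval : Continuous fun φ : XA A => φ ⟨eProj A g, eProj_mem g hg⟩ :=
    (WeakDual.eval_continuous _).comp continuous_subtype_val
  -- Because `φ(e_g)` is either `0` or `1`, the complement of the preimage of `b` is the locus where
  -- `φ(e_g)` equals the opposite value, a closed condition in the weak-* topology.
  rw [continuous_discrete_rng]
  intro b
  rw [← isClosed_compl_iff]
  have hset : ((fun φ : XA A => i₂ A φ g) ⁻¹' {b})ᶜ =
      {φ : XA A | φ ⟨eProj A g, eProj_mem g hg⟩ = if b = true then 0 else 1} := by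
    ext φ
    simp only [Set.mem_compl_iff, Set.mem_preimage, Set.mem_singleton_iff, Set.mem_ofPred_eq,
      i₂_spec φ g hg]
    cases b <;> cases i₂ A φ g <;> simp
  rw [hset]
  exact isClosed_eq heval continuous_const

/-- Injectivity of `i₂` on all of `X_A` is not needed: a character with the same configuration as
`i₁ A x` charges all initial words of `x`, and this already forces it to be `i₁ A x`. -/
theorem range_i₁_eq_preimage (A : TransitionMatrix) :
    Set.range (i₁ A) = Set.rangeFactorization (i₂ A) ⁻¹' shiftImage A := by
  ext φ
  constructor
  · rintro ⟨x, rfl⟩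
    exact ⟨x, rfl⟩
  · rintro ⟨x, hx⟩
    have hx' : i₂ A (i₁ A x) = i₂ A φ := hx
    refine ⟨x, (eq_i₁_of_i₂_initialWord fun n => ?_).symm⟩
    rw [← hx']
    exact i₂_i₁_initialWord x n

theorem isGδ_range_i₁ (A : TransitionMatrix) : IsGδ (Set.range (i₁ A)) := by
  rw [range_i₁_eq_preimage]
  exact (isGδ_shiftImage A).preimage ((continuous_i₂ A).rangeFactorization)

theorem measurableSet_borel_of_isGδ {X : Type*} [TopologicalSpace X] {s : Set X} (hs : IsGδ s) :
    @MeasurableSet X (borel X) s := by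
  borelize X
  exact hs.measurableSet

end ExelLaca

theorem mainTheorem8 (A : ExelLaca.TransitionMatrix) :
    @MeasurableSet (ExelLaca.ConfigSpace A) (borel (ExelLaca.ConfigSpace A)) (ExelLaca.shiftImage A) ∧
    IsGδ (ExelLaca.shiftImage A) ∧
    (∀ α : List ℕ, ExelLaca.IsAdmissible A α → IsClosed (ExelLaca.withStem A α)) ∧
    (ExelLaca.shiftImage A)ᶜ =
      ⋃ α ∈ {α : List ℕ | ExelLaca.IsAdmissible A α}, ExelLaca.withStem A α ∧
    @MeasurableSet (ExelLaca.XA A) (borel (ExelLaca.XA A)) (Set.range (ExelLaca.i₁ A)) ∧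
    IsGδ (Set.range (ExelLaca.i₁ A)) :=
  ⟨ExelLaca.measurableSet_borel_of_isGδ (ExelLaca.isGδ_shiftImage A), ExelLaca.isGδ_shiftImage A,
    fun α _ => ExelLaca.isClosed_withStem α, ExelLaca.compl_shiftImage A,
    ExelLaca.measurableSet_borel_of_isGδ (ExelLaca.isGδ_range_i₁ A), ExelLaca.isGδ_range_i₁ A⟩
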